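/- All graphs are finite and simple. The line graph $L(G)$ has the edges of $G$ as its vertices, two distinct edges being adjacent when they share an endpoint; the square $H^2$ of a graph $H$ has the vertices of $H$, two distinct vertices being adjacent when their distance in $H$ is at most $2$; a graph is perfect if in each of its induced subgraphs the chromatic number equals the clique number. For $n\ge 3$ and $i,j\in\{1,\dots,n\}$, call $i,j$ *apart* (modulo $n$) if $j\not\equiv i-1,\,i,\,i+1 \pmod n$. A *sunflower sprout of size $n$* is a graph with vertex set $U\cup V$, $U\cap V=\emptyset$, where $V=\{v_1,\dots,v_n\}$ consists of $n$ distinct vertices inducing a cycle $v_1v_2\cdots v_nv_1$, and $U=\{u_1,\dots,u_n\}$, where the $u_i$ need not be distinct, but $u_i\neq u_j$ whenever $i,j$ are apart, and $v_iu_i$ is an edge for all $i$. It is *fertile* if it has no edge $u_iu_j$ and no edge $u_iv_j$ with $i,j$ apart. A *fertile sprout of type $A$* is a graph on nine distinct vertices $x_0,\dots,x_5,y_0,y_1,y_2$ such that $x_0,\dots,x_5$ induce the cycle $x_0x_1\cdots x_5x_0$, the pending edges $y_0x_0$, $y_1x_1$, $y_2x_2$ are present, and, for the five edges $$f_1=y_0x_0,\quad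 f_2=y_1x_1,\quad f_3=y_2x_2,\quad f_4=x_3x_4,\quad f_5=x_4x_5,$$ there is no edge between an endpoint of $f_i$ and an endpoint of $f_j$ when $i,j$ are apart (modulo $5$). (So, besides the nine edges above, exactly the edges $y_0y_1$, $y_1y_2$, $y_0x_1$, $y_0x_5$, $y_1x_0$, $y_1x_2$, $y_2x_1$, $y_2x_3$ may or may not be present, in any combination.) **Theorem.** Let $G$ be a graph such that $L(G)^2$ is perfect. Then $G$ contains, as an induced subgraph, none of the following: 1. a cycle $C_n$ with $n\ge 7$; 2. a fertile sunflower sprout of size $5$; 3. a fertile sprout of type $A$. -/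

import Mathlib

namespace LineSquare

/-- The `k`-th power of a graph: distinct vertices are adjacent when their distance is at most `k`.
The distance is the extended one, so it is infinite between different components. -/
def power {V : Type*} (G : SimpleGraph V) (k : ℕ) : SimpleGraph V where
  Adj x y := x ≠ y ∧ G.edist x y ≤ k
  symm := ⟨fun x y h => ⟨h.1.symm, by rw [SimpleGraph.edist_comm]; exact h.2⟩⟩
  loopless := ⟨fun _ h => h.1 rfl⟩

/-- A graph is perfect if in every induced subgraph the chromatic number equals the clique number
(to be used for finite graphs). -/
def IsPerfect {V : Type*} (G : SimpleGraph V) : Prop :=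
  ∀ s : Set V, (G.induce s).chromaticNumber = ((G.induce s).cliqueNum : ℕ∞)

/-- `i` and `j` are distinct and not cyclically consecutive, i.e. `j ∉ {i - 1, i, i + 1}` modulo
`n`. -/
def Apart {n : ℕ} (i j : Fin n) : Prop :=
  i ≠ j ∧ ¬ (SimpleGraph.cycleGraph n).Adj i j

/-- `S` is a sunflower sprout of size `n`, presented by the induced cycle `v₁, …, vₙ` and the
vertices `u₁, …, uₙ`, where only cyclically consecutive `uᵢ` may coincide.  These are all the
vertices of `S`. -/
structure IsSunflowerSprout {X : Type*} (S : SimpleGraph X) (n : ℕ) (v u : Fin n → X) :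
    Prop where
  three_le : 3 ≤ n
  injective : Function.Injective v
  induced_cycle : ∀ i j, S.Adj (v i) (v j) ↔ (SimpleGraph.cycleGraph n).Adj i j
  disjoint : ∀ i j, u i ≠ v j
  ne_of_apart : ∀ i j, Apart i j → u i ≠ u j
  adj : ∀ i, S.Adj (v i) (u i)
  cover : ∀ x, x ∈ Set.range v ∪ Set.range u

/-- `S` is a fertile sunflower sprout of size `n`: there is no edge `uᵢuⱼ` and no edge `uᵢvⱼ` with
`i`, `j` distinct and not cyclically consecutive. -/
def IsFertileSunflowerSprout {X : Type*} (S : SimpleGraph X) (n : ℕ) : Prop :=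
  ∃ v u : Fin n → X, IsSunflowerSprout S n v u ∧
    ∀ i j, Apart i j → ¬ S.Adj (u i) (u j) ∧ ¬ S.Adj (u i) (v j)

/-- The fertility condition for the cyclically ordered `u`-edges `f₁, …, fₙ` of a sprout: no edge of
`S` connects two non-consecutive `u`-edges. -/
def FertileEdges {X : Type*} (S : SimpleGraph X) {n : ℕ} (f : Fin n → Sym2 X) : Prop :=
  ∀ i j, Apart i j → ∀ a ∈ f i, ∀ b ∈ f j, ¬ S.Adj a b

/-- `S` is a sprout of type A, presented by its base cycle `x₀, …, x₅`, which is induced, and the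
outer endpoints `y₀, y₁, y₂` of its pending edges `yᵢxᵢ`.  These nine vertices are distinct and are
all the vertices of `S`. The `w`-edges are `x₅x₀, x₀x₁, x₁x₂, x₂x₃`. -/
structure IsSproutA {X : Type*} (S : SimpleGraph X) (x : Fin 6 → X) (y : Fin 3 → X) :
    Prop where
  bijective : Function.Bijective (Sum.elim x y)
  induced_cycle : ∀ i j, S.Adj (x i) (x j) ↔ (SimpleGraph.cycleGraph 6).Adj i j
  pending₀ : S.Adj (y 0) (x 0)
  pending₁ : S.Adj (y 1) (x 1)
  pending₂ : S.Adj (y 2) (x 2)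

/-- The five `u`-edges of a sprout of type A in their cyclic order: the three pending edges and the
two adjacent edges `x₃x₄`, `x₄x₅` of the base cycle. -/
def uEdgesA {X : Type*} (x : Fin 6 → X) (y : Fin 3 → X) : Fin 5 → Sym2 X :=
  ![s(y 0, x 0), s(y 1, x 1), s(y 2, x 2), s(x 3, x 4), s(x 4, x 5)]

/-- `S` is a fertile sprout of type A. -/
def IsFertileSproutA {X : Type*} (S : SimpleGraph X) : Prop :=
  ∃ (x : Fin 6 → X) (y : Fin 3 → X), IsSproutA S x y ∧ FertileEdges S (uEdgesA x y)

end LineSquare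

namespace LineSquare

open SimpleGraph

/-! Two edges of `G` are adjacent in the squared line graph iff they are distinct and touch: they
share an endpoint or are joined by an edge. A family of edges whose touching pattern is a graph `K`
thus makes `K` an induced subgraph of a perfect graph, so `K` cannot need more colors than its
clique number. Each forbidden configuration yields such a family with an imperfect `K`
(`colorable_of_edges`). In a fertile sprout the five `u`-edges touch in the pattern of a five-cycle.
The edges of an induced `C_n` give the square of `C_n`. For `n = 7` that square has clique number 3
but is not 3-colorable. For `n ≥ 8` it contains an odd hole: go once around in `m` steps, `m ≥ 5`
odd, of length 1 or 2 with no two consecutive steps of length 1. With `a` short steps this needs `n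
= 2m - a` and `2a ≤ m`. -/

/-- An induced subgraph of a perfect graph without cliques of size `k + 1` is `k`-colorable. -/
theorem IsPerfect.colorable_of_embedding {W X : Type*} {H : SimpleGraph W} {K : SimpleGraph X}
    (hH : IsPerfect H) (e : K ↪g H) {k : ℕ} (hK : K.CliqueFree (k + 1)) : K.Colorable k := by
  let f : K →g H.induce (Set.range e) :=
    ⟨fun x => ⟨e x, x, rfl⟩, fun h => e.map_rel_iff.2 h⟩
  have hfree : (H.induce (Set.range e)).CliqueFree (k + 1) := by
    let g : H.induce (Set.range e) →g K :=
      ⟨fun y => y.2.choose, fun {a b} h => by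
        rw [← e.map_rel_iff, a.2.choose_spec, b.2.choose_spec]
        exact h⟩
    have hg : Function.Injective g := fun a b h => by
      have h' : a.2.choose = b.2.choose := h
      exact Subtype.ext (a.2.choose_spec.symm.trans ((congrArg e h').trans b.2.choose_spec))
    exact hK.comap ⟨⟨g, hg⟩⟩
  have hle : (H.induce (Set.range e)).cliqueNum ≤ k := by
    by_contra! hlt
    obtain ⟨t, ht⟩ := (H.induce (Set.range e)).exists_isNClique_cliqueNum
    exact hfree.mono hlt t ht
  refine Colorable.of_hom f (chromaticNumber_le_iff_colorable.1 ?_)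
  rw [hH]
  exact_mod_cast hle

/-! ### Adjacency in the square of a line graph -/

theorem edist_le_two_iff {V : Type*} {G : SimpleGraph V} {x y : V} :
    G.edist x y ≤ 2 ↔ x = y ∨ G.Adj x y ∨ ∃ z, G.Adj x z ∧ G.Adj z y := by
  constructor
  · intro h
    obtain ⟨p, hp⟩ := exists_walk_of_edist_ne_top (ne_top_of_le_ne_top (by decide) h)
    rw [← hp] at h
    have h2 : p.length ≤ 2 := by exact_mod_cast h
    match p, h2 with
    | .nil, _ => exact .inl rfl
    | .cons h1 .nil, _ => exact .inr (.inl h1)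
    | .cons h1 (.cons h2 .nil), _ => exact .inr (.inr ⟨_, h1, h2⟩)
    | .cons _ (.cons _ (.cons _ _)), h => simp at h
  · rintro (rfl | h | ⟨z, h1, h2⟩)
    · simp
    · exact (Walk.cons h .nil).edist_le.trans (by norm_num)
    · exact (Walk.cons h1 (.cons h2 .nil)).edist_le.trans (by norm_num)

/-- Two vertices are equal or adjacent. -/
def Touch {V : Type*} (G : SimpleGraph V) (a b : V) : Prop := a = b ∨ G.Adj a b

/-- Two edges are at distance at most two in the line graph exactly when they are equal, share an
endpoint or are joined by an edge. -/
theorem power_lineGraph_adj {V : Type*} {G : SimpleGraph V} {e f : G.edgeSet} :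
    (power G.lineGraph 2).Adj e f ↔
      e ≠ f ∧ ∃ a ∈ e.1, ∃ b ∈ f.1, Touch G a b := by
  refine and_congr_right fun hne => ?_
  change G.lineGraph.edist e f ≤ 2 ↔ _
  rw [edist_le_two_iff]
  constructor
  · rintro (h | h | ⟨g, h1, h2⟩)
    · exact absurd h hne
    · obtain ⟨-, a, ha, hb⟩ := h
      exact ⟨a, ha, a, hb, .inl rfl⟩
    · obtain ⟨-, a, ha, ha'⟩ := h1
      obtain ⟨-, b, hb', hb⟩ := h2
      refine ⟨a, ha, b, hb, ?_⟩
      by_cases hab : a = b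
      · exact .inl hab
      · have hg : g.1 = s(a, b) := (Sym2.mem_and_mem_iff hab).1 ⟨ha', hb'⟩
        exact .inr (by rw [← mem_edgeSet, ← hg]; exact g.2)
  · rintro ⟨a, ha, b, hb, rfl | h⟩
    · exact .inr (.inl ⟨hne, a, ha, hb⟩)
    -- The joining edge `ab` is itself the midpoint of a path from `e` to `f`, unless it equals one
    -- of them; then `e` and `f` already share an endpoint.
    · by_cases h1 : e = ⟨s(a, b), h⟩
      · exact .inr (.inl ⟨hne, b, by rw [h1]; simp, hb⟩)
      by_cases h2 : (⟨s(a, b), h⟩ : G.edgeSet) = f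
      · exact .inr (.inl ⟨hne, a, ha, by rw [← h2]; simp⟩)
      exact .inr (.inr ⟨⟨s(a, b), h⟩, ⟨h1, a, ha, by simp⟩, ⟨h2, b, by simp, hb⟩⟩)

/-- Some endpoint of the edge `ab` touches some endpoint of the edge `cd`. -/
def Near {V : Type*} (G : SimpleGraph V) (a b c d : V) : Prop :=
  Touch G a c ∨ Touch G a d ∨ Touch G b c ∨ Touch G b d

/-- If the edges `a i b i` of `G` are distinct and are near each other exactly when adjacent in
`K`, then `K` is an induced subgraph of the square of the line graph; if that square is perfect,
`K` is colorable with as many colors as its cliques require. -/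
theorem colorable_of_edges {V X : Type*} {G : SimpleGraph V}
    (hG : IsPerfect (power G.lineGraph 2)) {K : SimpleGraph X} (a b : X → V)
    (hab : ∀ i, G.Adj (a i) (b i))
    (hadj : ∀ i j, K.Adj i j → s(a i, b i) ≠ s(a j, b j) ∧ Near G (a i) (b i) (a j) (b j))
    (hnadj : ∀ i j, i ≠ j → ¬ K.Adj i j → ¬ Near G (a i) (b i) (a j) (b j))
    {k : ℕ} (hK : K.CliqueFree (k + 1)) : K.Colorable k := by
  -- For nonadjacent indices distinctness is free, since equal edges are near each other.
  have hinj : ∀ i j, i ≠ j → s(a i, b i) ≠ s(a j, b j) := by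
    intro i j hij
    by_cases h : K.Adj i j
    · exact (hadj i j h).1
    · intro he
      apply hnadj i j hij h
      rcases Sym2.eq_iff.1 he with h | h
      · exact .inl (.inl h.1)
      · exact .inr (.inl (.inl h.1))
  let e : K ↪g power G.lineGraph 2 :=
    { toFun := fun i => ⟨s(a i, b i), hab i⟩
      inj' := fun i j h => by
        by_contra hij
        exact hinj i j hij (congrArg Subtype.val h)
      map_rel_iff' := by
        intro i j
        change (power G.lineGraph 2).Adj ⟨s(a i, b i), hab i⟩ ⟨s(a j, b j), hab j⟩ ↔ _
        rw [power_lineGraph_adj]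
        constructor
        · rintro ⟨hne, x, hx, y, hy, hxy⟩
          by_contra hK
          refine hnadj i j (fun h => hne (by subst h; rfl)) hK ?_
          rcases Sym2.mem_iff.1 hx with rfl | rfl <;> rcases Sym2.mem_iff.1 hy with rfl | rfl
          · exact .inl hxy
          · exact .inr (.inl hxy)
          · exact .inr (.inr (.inl hxy))
          · exact .inr (.inr (.inr hxy))
        · intro hK
          obtain ⟨hne, hN⟩ := hadj i j hK
          refine ⟨fun h => hne (congrArg Subtype.val h), ?_⟩
          rcases hN with h | h | h | h
          · exact ⟨_, Sym2.mem_mk_left _ _, _, Sym2.mem_mk_left _ _, h⟩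
          · exact ⟨_, Sym2.mem_mk_left _ _, _, Sym2.mem_mk_right _ _, h⟩
          · exact ⟨_, Sym2.mem_mk_right _ _, _, Sym2.mem_mk_left _ _, h⟩
          · exact ⟨_, Sym2.mem_mk_right _ _, _, Sym2.mem_mk_right _ _, h⟩ }
  exact hG.colorable_of_embedding e hK

/-! ### Odd holes -/

theorem cycleGraph_adj_val {n : ℕ} (hn : 3 ≤ n) {i j : Fin n} :
    (cycleGraph n).Adj i j ↔ i.val + 1 = j.val ∨ j.val + 1 = i.val ∨
      (i.val = 0 ∧ j.val + 1 = n) ∨ (j.val = 0 ∧ i.val + 1 = n) := by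
  have hi := i.2
  have hj := j.2
  rw [cycleGraph_adj']
  rcases lt_or_ge j i with h | h
  · rw [Fin.sub_val_of_le h.le, Fin.val_sub]
    rw [Nat.mod_eq_of_lt (by have : j.val < i.val := h; omega)]
    have : j.val < i.val := h
    omega
  · rw [Fin.sub_val_of_le h, Fin.val_sub]
    have h' : i.val ≤ j.val := h
    rcases h'.eq_or_lt with he | hl
    · rw [he, Nat.sub_add_cancel hj.le, Nat.mod_self]
      omega
    · rw [Nat.mod_eq_of_lt (by omega)]
      omega

theorem cycleGraph_cliqueFree {n : ℕ} (hn : 4 ≤ n) : (cycleGraph n).CliqueFree 3 := by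
  intro t ht
  obtain ⟨x, y, z, hxy, hxz, hyz, -⟩ := is3Clique_iff.1 ht
  rw [cycleGraph_adj_val (by omega)] at hxy hxz hyz
  omega

theorem cycleGraph_not_colorable {n : ℕ} (hn : 3 ≤ n) (hodd : Odd n) :
    ¬ (cycleGraph n).Colorable 2 := by
  intro h
  have h1 := chromaticNumber_le_iff_colorable.2 h
  rw [chromaticNumber_cycleGraph_of_odd n (by omega) hodd] at h1
  exact absurd h1 (by decide)

/-- In a graph whose squared line graph is perfect, no edges are arranged as an odd hole. -/
theorem false_of_odd_hole {V : Type*} {G : SimpleGraph V}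
    (hG : IsPerfect (power G.lineGraph 2)) {m : ℕ} (hm : 5 ≤ m) (hodd : Odd m)
    (a b : Fin m → V) (hab : ∀ i, G.Adj (a i) (b i))
    (hadj : ∀ i j, (cycleGraph m).Adj i j →
      s(a i, b i) ≠ s(a j, b j) ∧ Near G (a i) (b i) (a j) (b j))
    (hnadj : ∀ i j, Apart i j → ¬ Near G (a i) (b i) (a j) (b j)) : False :=
  cycleGraph_not_colorable (by omega) hodd
    (colorable_of_edges hG a b hab hadj (fun i j h h' => hnadj i j ⟨h, h'⟩)
      (cycleGraph_cliqueFree (by omega)))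

theorem near_embedding {V W : Type*} {G : SimpleGraph V} {H : SimpleGraph W} (φ : H ↪g G)
    {a b c d : W} : Near G (φ a) (φ b) (φ c) (φ d) ↔ Near H a b c d := by
  simp only [Near, Touch, φ.injective.eq_iff, φ.map_adj_iff]

theorem sym2_embedding_ne {V W : Type*} {φ : W → V} (hφ : Function.Injective φ)
    {a b c d : W} (h : s(a, b) ≠ s(c, d)) : s(φ a, φ b) ≠ s(φ c, φ d) := fun h' =>
  h (Sym2.map.injective hφ h')

/-! ### The cycle of length seven -/

/-- The square of the cycle of length seven. -/
def cycleSevenSquare : SimpleGraph (Fin 7) where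
  Adj i j := i - j ∈ ({1, 2, 5, 6} : Finset (Fin 7))
  symm := ⟨by decide⟩
  loopless := ⟨by decide⟩

instance : DecidableRel cycleSevenSquare.Adj := fun i j =>
  inferInstanceAs (Decidable (i - j ∈ ({1, 2, 5, 6} : Finset (Fin 7))))

set_option maxRecDepth 10000 in
theorem cycleSevenSquare_cliqueFree : cycleSevenSquare.CliqueFree 4 := by
  intro t ht
  have h : ∀ s ∈ (Finset.univ : Finset (Fin 7)).powersetCard 4,
      ∃ x ∈ s, ∃ y ∈ s, x ≠ y ∧ ¬ cycleSevenSquare.Adj x y := by decide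
  obtain ⟨x, hx, y, hy, hxy, hn⟩ := h t (Finset.mem_powersetCard_univ.2 ht.card_eq)
  exact hn (ht.isClique hx hy hxy)

/-- Any three consecutive vertices form a triangle, so a 3-coloring would repeat with period 3 along
`0, …, 6`. Then `6` gets the color of `0`, to which it is adjacent. -/
theorem cycleSevenSquare_not_colorable : ¬ cycleSevenSquare.Colorable 3 := by
  rintro ⟨c⟩
  have h : ∀ i j, cycleSevenSquare.Adj i j → (c i).val ≠ (c j).val := fun i j hij he =>
    c.valid hij (Fin.ext he)
  have h01 := h 0 1 (by decide)
  have h02 := h 0 2 (by decide)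
  have h12 := h 1 2 (by decide)
  have h13 := h 1 3 (by decide)
  have h23 := h 2 3 (by decide)
  have h24 := h 2 4 (by decide)
  have h34 := h 3 4 (by decide)
  have h35 := h 3 5 (by decide)
  have h45 := h 4 5 (by decide)
  have h46 := h 4 6 (by decide)
  have h56 := h 5 6 (by decide)
  have h60 := h 6 0 (by decide)
  have e3 : (c 3).val = (c 0).val := by omega
  have e4 : (c 4).val = (c 1).val := by omega
  have e5 : (c 5).val = (c 2).val := by omega
  omega

theorem not_isIndContained_cycleGraph_seven {V : Type*} {G : SimpleGraph V}
    (hG : IsPerfect (power G.lineGraph 2)) : ¬ (cycleGraph 7).IsIndContained G := by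
  rintro ⟨φ⟩
  refine cycleSevenSquare_not_colorable (colorable_of_edges hG (fun i => φ i)
    (fun i => φ (i + 1)) (fun i => φ.map_adj_iff.2 ?_) (fun i j h => ?_) (fun i j h h' => ?_)
    cycleSevenSquare_cliqueFree)
  · revert i; decide
  · rw [near_embedding]
    refine ⟨sym2_embedding_ne φ.injective ?_, ?_⟩
    · revert i j; decide
    · unfold Near Touch; revert i j; decide
  · rw [near_embedding]
    unfold Near Touch; revert i j; decide

/-! ### Cycles of length at least eight -/

/-- The length `m` of an odd hole in the square of a long cycle of length `2 * m - a`. -/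
theorem exists_odd_hole_length {n : ℕ} (hn : 8 ≤ n) :
    ∃ m a, 5 ≤ m ∧ Odd m ∧ 2 * a ≤ m ∧ n + a = 2 * m := by
  -- Oddness of `m` means `n + a ≡ 2` modulo 4, so `a` is the residue of `2 - n`; the summand `4 *
  -- n` prevents truncated subtraction. For `n = 7` this would give `m = 5`, `a = 3`, violating `2 *
  -- a ≤ m`.
  refine ⟨(n + (4 * n + 2 - n) % 4) / 2, (4 * n + 2 - n) % 4, ?_, Nat.odd_iff.2 ?_, ?_, ?_⟩ <;>
    omega

/-- The edges leaving `i` and `k` forward in a cycle are near each other if and only if `i` and `k`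
are at cyclic distance at most two. -/
theorem cycleGraph_near {n : ℕ} (hn : 3 ≤ n) {i j k l : Fin n} (hij : j.val = i.val + 1)
    (hkl : l.val = k.val + 1) (hik : i < k) :
    Near (cycleGraph n) i j k l ↔ k.val ≤ i.val + 2 ∨ i.val + n ≤ k.val + 2 := by
  have h : i.val < k.val := hik
  have := l.2
  simp only [Near, Touch, cycleGraph_adj_val hn, Fin.ext_iff, hij, hkl]
  omega

theorem Near.symm {V : Type*} {G : SimpleGraph V} {a b c d : V} (h : Near G a b c d) :
    Near G c d a b := by
  simp only [Near, Touch, G.adj_comm, eq_comm] at h ⊢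
  tauto

/-- The position in a cycle of the `i`-th vertex of an odd hole of its square that takes `a` single
steps, each after an even vertex of the hole, and double steps otherwise. -/
def holePosition (a i : ℕ) : ℕ := 2 * i - min a ((i + 1) / 2)

theorem holePosition_lt {a i j : ℕ} (h : i < j) : holePosition a i < holePosition a j := by
  unfold holePosition
  omega

theorem holePosition_succ_le (a i : ℕ) : holePosition a (i + 1) ≤ holePosition a i + 2 := by
  unfold holePosition
  omega

/-- Single steps occur only after even vertices, so of two consecutive steps at least one is double.
This keeps nonconsecutive hole vertices out of reach. -/
theorem holePosition_add_three_le {a i j : ℕ} (h : i + 2 ≤ j) :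
    holePosition a i + 3 ≤ holePosition a j := by
  unfold holePosition
  omega

/-- By `2 * a ≤ m` all single steps have been used by then. When `n = 2 * m - a`, the step closing
the hole therefore has length 2. -/
theorem holePosition_last {m a : ℕ} (hm : 1 ≤ m) (ham : 2 * a ≤ m) :
    holePosition a (m - 1) = 2 * m - 2 - a := by
  unfold holePosition
  omega

theorem not_isIndContained_cycleGraph {V : Type*} {G : SimpleGraph V}
    (hG : IsPerfect (power G.lineGraph 2)) {n : ℕ} (hn : 7 ≤ n) :
    ¬ (cycleGraph n).IsIndContained G := by
  rcases hn.eq_or_lt with rfl | hn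
  · exact not_isIndContained_cycleGraph_seven hG
  rintro ⟨φ⟩
  obtain ⟨m, a, hm, hodd, ham, hnm⟩ := exists_odd_hole_length hn
  have hlast := holePosition_last (by omega) ham
  have hmono : ∀ {i j : ℕ}, i ≤ j → holePosition a i ≤ holePosition a j := fun {i j} h =>
    h.eq_or_lt.elim (fun h => h ▸ le_rfl) fun h => (holePosition_lt h).le
  -- The last chosen edge starts at position `n - 2`, so no chosen edge wraps around the cycle.
  have hlt : ∀ i : Fin m, holePosition a i + 1 < n := fun i => by
    have := i.2
    have := hmono (show i.val ≤ m - 1 by omega)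
    omega
  let p : Fin m → Fin n := fun i => ⟨holePosition a i, (Nat.lt_succ_self _).trans (hlt i)⟩
  let q : Fin m → Fin n := fun i => ⟨holePosition a i + 1, hlt i⟩
  have hpq : ∀ {i j}, i < j → p i < p j := fun h => holePosition_lt h
  have hnear : ∀ i j : Fin m, i < j →
      (Near (cycleGraph n) (p i) (q i) (p j) (q j) ↔ (cycleGraph m).Adj i j) := by
    intro i j hij
    have hij' : i.val < j.val := hij
    have hj := j.2
    rw [cycleGraph_near (by omega) rfl rfl (hpq hij), cycleGraph_adj_val (by omega)]
    change holePosition a j ≤ holePosition a i + 2 ∨ holePosition a i + n ≤ holePosition a j + 2 ↔ _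
    have h0 : holePosition a 0 = 0 := by simp [holePosition]
    constructor
    · rintro (h | h)
      · by_contra hne
        have := holePosition_add_three_le (a := a) (show i.val + 2 ≤ j.val by omega)
        omega
      -- Nearness across the wrap-around: positions lie between `0` and `n - 2`, which forces `i` to
      -- be the first and `j` the last vertex of the hole.
      · have h1 := hmono (show j.val ≤ m - 1 by omega)
        have h2 : i.val = 0 := by
          by_contra hi
          have := holePosition_lt (a := a) (show 0 < i.val by omega)
          omega
        have h3 : j.val + 1 = m := by
          by_contra hne
          rw [h2, h0] at h
          have := holePosition_lt (a := a) (show j.val < m - 1 by omega)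
          omega
        omega
    · rintro (h | h | ⟨hi, h⟩ | ⟨_, _⟩)
      · have := holePosition_succ_le a i.val
        rw [h] at this
        exact .inl this
      · omega
      · rw [hi, h0, show j.val = m - 1 by omega, hlast]
        omega
      · omega
  have hnear' : ∀ i j : Fin m, i ≠ j →
      (Near (cycleGraph n) (p i) (q i) (p j) (q j) ↔ (cycleGraph m).Adj i j) := by
    intro i j hij
    rcases hij.lt_or_gt with h | h
    · exact hnear i j h
    · rw [(cycleGraph m).adj_comm, ← hnear j i h]
      exact ⟨Near.symm, Near.symm⟩
  refine false_of_odd_hole hG hm hodd (fun i => φ (p i)) (fun i => φ (q i))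
    (fun i => φ.map_adj_iff.2 ?_) (fun i j h => ?_) (fun i j h => ?_)
  · rw [cycleGraph_adj_val (by omega)]
    exact .inl rfl
  · rw [near_embedding]
    refine ⟨sym2_embedding_ne φ.injective fun h' => ?_, (hnear' i j h.ne).2 h⟩
    have hne : (p i).val ≠ (p j).val := by
      rcases h.ne.lt_or_gt with h | h
      · exact Fin.val_ne_of_ne (hpq h).ne
      · exact Fin.val_ne_of_ne (hpq h).ne'
    simp only [Sym2.eq_iff, Fin.ext_iff, show ∀ i, (q i).val = (p i).val + 1 from fun _ => rfl]
      at h'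
    omega
  · rw [near_embedding, hnear' i j h.1]
    exact h.2

/-! ### Fertile sprouts -/

theorem not_isFertileSunflowerSprout {V : Type*} {G : SimpleGraph V}
    (hG : IsPerfect (power G.lineGraph 2)) (s : Set V) :
    ¬ IsFertileSunflowerSprout (G.induce s) 5 := by
  rintro ⟨v, u, hS, hF⟩
  let φ : G.induce s ↪g G := Embedding.induce s
  have hFs : ∀ i j : Fin 5, Apart i j → Apart j i := fun i j h => ⟨h.1.symm, fun h' => h.2 h'.symm⟩
  -- The edges `vᵢuᵢ` form the five-hole: consecutive ones are joined by the cycle edge between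
  -- their `v`-ends and remain distinct even if their `u`-ends coincide. Fertility separates the
  -- others.
  refine false_of_odd_hole hG le_rfl (by decide) (fun i => φ (v i)) (fun i => φ (u i))
    (fun i => φ.map_adj_iff.2 (hS.adj i)) (fun i j h => ?_) (fun i j h => ?_)
  · rw [near_embedding]
    refine ⟨sym2_embedding_ne φ.injective fun h' => ?_,
      .inl (.inr ((hS.induced_cycle i j).2 h))⟩
    rcases Sym2.eq_iff.1 h' with h' | h'
    · exact h.ne (hS.injective h'.1)
    · exact hS.disjoint j i h'.1.symm
  · rw [near_embedding]
    rintro ((h' | h') | (h' | h') | (h' | h') | (h' | h'))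
    · exact h.1 (hS.injective h')
    · exact h.2 ((hS.induced_cycle i j).1 h')
    · exact hS.disjoint j i h'.symm
    · exact (hF j i (hFs i j h)).2 h'.symm
    · exact hS.disjoint i j h'
    · exact (hF i j h).2 h'
    · exact hS.ne_of_apart i j h h'
    · exact (hF i j h).1 h'

theorem not_isFertileSproutA {V : Type*} {G : SimpleGraph V}
    (hG : IsPerfect (power G.lineGraph 2)) (s : Set V) :
    ¬ IsFertileSproutA (G.induce s) := by
  rintro ⟨x, y, hS, hF⟩
  let φ : G.induce s ↪g G := Embedding.induce s
  -- Endpoints are named by labels in `Fin 6 ⊕ Fin 3`, so that disjointness of nonconsecutive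
  -- `u`-edges is a finite check on labels, transferred by injectivity of `z`.
  let α : Fin 5 → Fin 6 ⊕ Fin 3 := ![.inr 0, .inr 1, .inr 2, .inl 3, .inl 4]
  let β : Fin 5 → Fin 6 ⊕ Fin 3 := ![.inl 0, .inl 1, .inl 2, .inl 4, .inl 5]
  let z := Sum.elim x y
  have hz : Function.Injective z := hS.bijective.1
  have hedge : ∀ i, uEdgesA x y i = s(z (α i), z (β i)) := by
    intro i; fin_cases i <;> rfl
  have hx : ∀ i j, (cycleGraph 6).Adj i j → (G.induce s).Adj (x i) (x j) := fun i j =>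
    (hS.induced_cycle i j).2
  have hadj : ∀ i, (G.induce s).Adj (z (α i)) (z (β i)) := by
    intro i
    fin_cases i
    · exact hS.pending₀
    · exact hS.pending₁
    · exact hS.pending₂
    · exact hx 3 4 (by decide)
    · exact hx 4 5 (by decide)
  -- Consecutive `u`-edges are joined by the four `w`-edges, except `x₃x₄` and `x₄x₅`, which share
  -- `x₄`.
  have hnext : ∀ i : Fin 5,
      Near (G.induce s) (z (α i)) (z (β i)) (z (α (i + 1))) (z (β (i + 1))) := by
    intro i
    fin_cases i
    · exact .inr (.inr (.inr (.inr (hx 0 1 (by decide)))))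
    · exact .inr (.inr (.inr (.inr (hx 1 2 (by decide)))))
    · exact .inr (.inr (.inl (.inr (hx 2 3 (by decide)))))
    · exact .inr (.inr (.inl (.inl rfl)))
    · exact .inr (.inr (.inr (.inr (hx 5 0 (by decide)))))
  refine false_of_odd_hole hG le_rfl (by decide) (fun i => φ (z (α i))) (fun i => φ (z (β i)))
    (fun i => φ.map_adj_iff.2 (hadj i)) (fun i j h => ?_) (fun i j h => ?_)
  · rw [near_embedding]
    refine ⟨sym2_embedding_ne φ.injective (sym2_embedding_ne hz ?_), ?_⟩
    · revert i j; decide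
    · have hij : j = i + 1 ∨ i = j + 1 := by revert i j; decide
      rcases hij with rfl | rfl
      · exact hnext i
      · exact (hnext j).symm
  · rw [near_embedding]
    have hne : α i ≠ α j ∧ α i ≠ β j ∧ β i ≠ α j ∧ β i ≠ β j := by
      unfold Apart at h; revert i j; decide
    have hF' := hF i j h
    rw [hedge, hedge] at hF'
    have hm : ∀ k, z (α k) ∈ s(z (α k), z (β k)) := fun k => Sym2.mem_mk_left _ _
    have hm' : ∀ k, z (β k) ∈ s(z (α k), z (β k)) := fun k => Sym2.mem_mk_right _ _
    rintro ((h' | h') | (h' | h') | (h' | h') | (h' | h'))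
    · exact hne.1 (hz h')
    · exact hF' _ (hm i) _ (hm j) h'
    · exact hne.2.1 (hz h')
    · exact hF' _ (hm i) _ (hm' j) h'
    · exact hne.2.2.1 (hz h')
    · exact hF' _ (hm' i) _ (hm j) h'
    · exact hne.2.2.2 (hz h')
    · exact hF' _ (hm' i) _ (hm' j) h'

end LineSquare

theorem mainTheorem8 {V : Type*} [Finite V] (G : SimpleGraph V)
    (hG : LineSquare.IsPerfect (LineSquare.power G.lineGraph 2)) :
    (∀ n : ℕ, 7 ≤ n → ¬ (SimpleGraph.cycleGraph n).IsIndContained G) ∧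
    (∀ s : Set V, ¬ LineSquare.IsFertileSunflowerSprout (G.induce s) 5) ∧
    (∀ s : Set V, ¬ LineSquare.IsFertileSproutA (G.induce s)) :=
  ⟨fun _ hn => LineSquare.not_isIndContained_cycleGraph hG hn,
    LineSquare.not_isFertileSunflowerSprout hG, LineSquare.not_isFertileSproutA hG⟩
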